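/- Let $n,m\ge 0$ and let $\alpha_1(s)\mid\dots\mid\alpha_n(s)$ be monic polynomials in $\mathbb R[s]$ with $\sum_{i=1}^n\deg\alpha_i=n$. A pair $(F,G)\in\mathbb R^{n\times n}\times\mathbb R^{n\times m}$ is controllable if $\operatorname{rank}[\,G\ \ FG\ \cdots\ F^{n-1}G\,]=n$. For such a pair let $$\mathcal H_{(F,G)}=\{K\in\mathbb R^{m\times n} : F+GK \text{ has invariant polynomials } \alpha_1,\dots,\alpha_n\},$$ where the invariant polynomials of a matrix $A\in\mathbb R^{n\times n}$ are the diagonal entries of the Smith normal form of $sI_n-A$ over $\mathbb R[s]$. Two controllable pairs $(F,G)$, $(F',G')$ are feedback equivalent if there are invertible $P\in\mathbb R^{n\times n}$, $Q\in\mathbb R^{m\times m}$ and a matrix $R\in\mathbb R^{m\times n}$ with $$[\,F'\ \ G'\,]=P^{-1}[\,F\ \ G\,]\begin{bmatrix}P&0\\R&Q\end{bmatrix}.$$ **Proposition 3.3.** Let $(F,G),(F',G')\in\mathbb R^{n\times n}\times\mathbb R^{n\times m}$ be controllable pairs. If $(F,G)$ and $(F',G')$ are feedback equivalent, then $\mathcal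 H_{(F,G)}$ and $\mathcal H_{(F',G')}$ are diffeomorphic. More precisely, for all $P,Q,R$ as above that realize the feedback equivalence, the affine map $\psi(K)=Q^{-1}(KP-R)$ restricts to a diffeomorphism $\mathcal H_{(F,G)}\to\mathcal H_{(F',G')}$. Here a diffeomorphism of subsets of real vector spaces of matrices is a bijection such that it and its inverse extend, locally around each point, to $C^\infty$ maps on open subsets of the ambient spaces. Moreover, $\psi$ restricts to a $C^\infty$ diffeomorphism of manifolds whenever $\mathcal H_{(F,G)}$ and $\mathcal H_{(F',G')}$ (with their subspace topologies) are given structures of smooth embedded submanifolds of $\mathbb R^{m\times n}$. -/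

import Mathlib

open scoped ContDiff Manifold Polynomial Matrix.Norms.Elementwise

namespace PoleAssignment

/-! ### Control systems -/

/-- The controllability matrix `[G  FG  ⋯  F^(n-1) G]`: the block with index `k` is `F ^ k * G`. -/
def controllabilityMatrix {n m : ℕ} (F : Matrix (Fin n) (Fin n) ℝ) (G : Matrix (Fin n) (Fin m) ℝ) :
    Matrix (Fin n) (Fin n × Fin m) ℝ :=
  Matrix.of fun i kj => (F ^ (kj.1 : ℕ) * G) i kj.2

/-- `(F, G)` is controllable: its controllability matrix has rank `n`. -/
def IsControllable {n m : ℕ} (F : Matrix (Fin n) (Fin n) ℝ) (G : Matrix (Fin n) (Fin m) ℝ) : Prop :=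
  (controllabilityMatrix F G).rank = n

/-- `(P, Q, R)` determines an element `[P 0; R Q]` of the feedback group (`P`, `Q` invertible)
which carries `(F, G)` to `(F', G')`, that is, `[F' G'] = P⁻¹ [F G] [P 0; R Q]`. -/
def IsFeedbackTransformation {n m : ℕ}
    (P : Matrix (Fin n) (Fin n) ℝ) (Q : Matrix (Fin m) (Fin m) ℝ) (R : Matrix (Fin m) (Fin n) ℝ)
    (F : Matrix (Fin n) (Fin n) ℝ) (G : Matrix (Fin n) (Fin m) ℝ)
    (F' : Matrix (Fin n) (Fin n) ℝ) (G' : Matrix (Fin n) (Fin m) ℝ) : Prop :=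
  IsUnit P ∧ IsUnit Q ∧
    Matrix.fromCols F' G' = P⁻¹ * Matrix.fromCols F G * Matrix.fromBlocks P 0 R Q

/-- `(F, G)` and `(F', G')` are feedback equivalent. -/
def FeedbackEquivalent {n m : ℕ}
    (F : Matrix (Fin n) (Fin n) ℝ) (G : Matrix (Fin n) (Fin m) ℝ)
    (F' : Matrix (Fin n) (Fin n) ℝ) (G' : Matrix (Fin n) (Fin m) ℝ) : Prop :=
  ∃ (P : Matrix (Fin n) (Fin n) ℝ) (Q : Matrix (Fin m) (Fin m) ℝ) (R : Matrix (Fin m) (Fin n) ℝ),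
    IsFeedbackTransformation P Q R F G F' G'

/-! ### Invariant polynomials and assigning feedbacks -/

/-- The monic polynomials `α₁ ∣ ⋯ ∣ αₙ` are the invariant polynomials of `A`: `diag(α₁, …, αₙ)` is
the Smith normal form of the polynomial matrix `s I - A`, i.e. it is obtained from `s I - A` by
multiplication on both sides with matrices that are invertible over `ℝ[s]`. -/
def HasInvariantPolynomials {n : ℕ} (A : Matrix (Fin n) (Fin n) ℝ) (α : Fin n → ℝ[X]) : Prop :=
  (∀ i, (α i).Monic) ∧ (∀ i j, i ≤ j → α i ∣ α j) ∧
    ∃ U V : Matrix (Fin n) (Fin n) ℝ[X],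
      IsUnit U ∧ IsUnit V ∧ U * A.charmatrix * V = Matrix.diagonal α

/-- `𝓗_(F,G)`: the set of the feedbacks `K` for which `F + G K` has the invariant polynomials
`α`. -/
def assigningFeedbacks {n m : ℕ} (α : Fin n → ℝ[X])
    (F : Matrix (Fin n) (Fin n) ℝ) (G : Matrix (Fin n) (Fin m) ℝ) :
    Set (Matrix (Fin m) (Fin n) ℝ) :=
  {K | HasInvariantPolynomials (F + G * K) α}

/-! ### Smooth maps between subsets of normed spaces

Matrix spaces carry the entrywise sup norm; smoothness does not depend on the choice of norm. -/

/-- A map between arbitrary subsets of normed spaces is smooth if around each point of its domain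
it extends to a `C^∞` map on an open subset of the ambient space. -/
def SmoothBetween {V W : Type*} [NormedAddCommGroup V] [NormedSpace ℝ V]
    [NormedAddCommGroup W] [NormedSpace ℝ W] {S : Set V} {T : Set W} (f : S → T) : Prop :=
  ∀ x : S, ∃ (U : Set V) (g : V → W), IsOpen U ∧ (x : V) ∈ U ∧ ContDiffOn ℝ ∞ g U ∧
    ∀ y : S, (y : V) ∈ U → (f y : W) = g y

/-- A diffeomorphism between subsets of normed spaces: a bijection, smooth in both directions. -/
structure SubsetDiffeo {V W : Type*} [NormedAddCommGroup V] [NormedSpace ℝ V]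
    [NormedAddCommGroup W] [NormedSpace ℝ W] (S : Set V) (T : Set W) extends S ≃ T where
  smooth_toFun : SmoothBetween toFun
  smooth_invFun : SmoothBetween invFun

/-- `S` (with its subspace topology and the charts at hand) is a `d`-dimensional smooth embedded
submanifold of the normed space `V`. -/
def IsEmbeddedSubmanifold {V : Type*} [NormedAddCommGroup V] [NormedSpace ℝ V] (d : ℕ) (S : Set V)
    [ChartedSpace (EuclideanSpace ℝ (Fin d)) S] : Prop :=
  IsManifold (𝓡 d) ∞ S ∧
    Manifold.IsSmoothEmbedding (𝓡 d) 𝓘(ℝ, V) ∞ (Subtype.val : S → V)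

/-- `f` restricts to a diffeomorphism of the manifolds `S` and `T`, where `S` and `T` carry any
structures of smooth embedded submanifolds of the ambient spaces. -/
def RestrictsToDiffeo {V W : Type*} [NormedAddCommGroup V] [NormedSpace ℝ V]
    [NormedAddCommGroup W] [NormedSpace ℝ W] (f : V → W) (S : Set V) (T : Set W) : Prop :=
  ∀ (d d' : ℕ) [ChartedSpace (EuclideanSpace ℝ (Fin d)) S]
    [ChartedSpace (EuclideanSpace ℝ (Fin d')) T],
    IsEmbeddedSubmanifold d S → IsEmbeddedSubmanifold d' T →
      ∃ Ψ : S ≃ₘ^∞⟮𝓡 d, 𝓡 d'⟯ T, ∀ x : S, (Ψ x : W) = f x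

end PoleAssignment

namespace PoleAssignment

open Matrix Manifold

/-! ### Mutually inverse smooth maps of the ambient spaces -/

section Smooth

variable {V W : Type*} [NormedAddCommGroup V] [NormedSpace ℝ V]
  [NormedAddCommGroup W] [NormedSpace ℝ W] {S : Set V} {T : Set W} {f : V → W} {g : W → V}

/-! Feedback equivalence amounts to F' = P⁻¹(FP + GR) and G' = P⁻¹GQ. Substituting K' = Q⁻¹(KP - R)
cancels the R terms and leaves F' + G'K' = P⁻¹(F + GK)P (`closedLoop_eq`). Similar matrices have the
same invariant polynomials (`hasInvariantPolynomials_conj_iff`), so K is assigning for one pair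
exactly when K' is for the other. Since K ↦ K' is an affine bijection of the whole matrix space with
affine inverse, both restrictions extend globally to smooth maps. This also settles the manifold
version, because smoothness into an embedded submanifold can be tested in the ambient space. -/

theorem smoothBetween_restrict (hf : ContDiff ℝ ∞ f) (φ : S → T) (hφ : ∀ x : S, (φ x : W) = f x) :
    SmoothBetween φ :=
  fun _ => ⟨Set.univ, f, isOpen_univ, Set.mem_univ _, hf.contDiffOn, fun y _ => hφ y⟩

/-- The bijection between two subsets given by mutually inverse maps of the ambient types. -/
def restrictEquiv (hST : ∀ x ∈ S, f x ∈ T) (hTS : ∀ y ∈ T, g y ∈ S)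
    (hgf : ∀ x, g (f x) = x) (hfg : ∀ y, f (g y) = y) : S ≃ T where
  toFun x := ⟨f x, hST x x.2⟩
  invFun y := ⟨g y, hTS y y.2⟩
  left_inv x := Subtype.ext (hgf x)
  right_inv y := Subtype.ext (hfg y)

theorem exists_subsetDiffeo (hf : ContDiff ℝ ∞ f) (hg : ContDiff ℝ ∞ g)
    (hST : ∀ x ∈ S, f x ∈ T) (hTS : ∀ y ∈ T, g y ∈ S)
    (hgf : ∀ x, g (f x) = x) (hfg : ∀ y, f (g y) = y) :
    ∃ Φ : SubsetDiffeo S T, ∀ x : S, (Φ.toEquiv x : W) = f x :=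
  ⟨{ restrictEquiv hST hTS hgf hfg with
      smooth_toFun := smoothBetween_restrict hf _ fun _ => rfl
      smooth_invFun := smoothBetween_restrict hg _ fun _ => rfl }, fun _ => rfl⟩

/-- A map between embedded submanifolds that extends to a smooth map of the ambient spaces is
smooth. -/
theorem contMDiff_of_isEmbeddedSubmanifold {d d' : ℕ} [ChartedSpace (EuclideanSpace ℝ (Fin d)) S]
    [ChartedSpace (EuclideanSpace ℝ (Fin d')) T] (hS : IsEmbeddedSubmanifold d S)
    (hT : IsEmbeddedSubmanifold d' T) (hf : ContDiff ℝ ∞ f) (φ : S → T)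
    (hφ : ∀ x : S, (φ x : W) = f x) : ContMDiff (𝓡 d) (𝓡 d') ∞ φ := by
  have := hS.1
  have := hT.1
  have hcomp : (Subtype.val : T → W) ∘ φ = f ∘ (Subtype.val : S → V) := funext hφ
  -- A map into an immersed manifold is smooth once it is continuous and its composite with the
  -- immersion is smooth; continuity holds because T carries the subspace topology.
  rw [ContMDiff.iff_comp_isImmersion hT.2.isImmersion]
  refine ⟨hT.2.isEmbedding.continuous_iff.2 ?_, ?_⟩
  · rw [hcomp]
    exact hf.continuous.comp continuous_subtype_val
  · rw [hcomp]
    exact hf.contMDiff.comp hS.2.contMDiff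

theorem restrictsToDiffeo (hf : ContDiff ℝ ∞ f) (hg : ContDiff ℝ ∞ g)
    (hST : ∀ x ∈ S, f x ∈ T) (hTS : ∀ y ∈ T, g y ∈ S)
    (hgf : ∀ x, g (f x) = x) (hfg : ∀ y, f (g y) = y) : RestrictsToDiffeo f S T := by
  intro d d' _ _ hS hT
  exact ⟨{ toEquiv := restrictEquiv hST hTS hgf hfg
           contMDiff_toFun := contMDiff_of_isEmbeddedSubmanifold hS hT hf _ fun _ => rfl
           contMDiff_invFun := contMDiff_of_isEmbeddedSubmanifold hT hS hg _ fun _ => rfl },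
    fun _ => rfl⟩

end Smooth

/-! ### Invariant polynomials and similarity -/

/-- The scalar matrix `X` commutes with the constant matrix P⁻¹, so conjugation by P fixes it. -/
theorem charmatrix_conj {n : ℕ} {P : Matrix (Fin n) (Fin n) ℝ} (hP : IsUnit P)
    (A : Matrix (Fin n) (Fin n) ℝ) :
    (P⁻¹ * A * P).charmatrix =
      Polynomial.C.mapMatrix P⁻¹ * A.charmatrix * Polynomial.C.mapMatrix P := by
  have hPP : (Polynomial.C.mapMatrix P⁻¹ : Matrix (Fin n) (Fin n) ℝ[X]) *
      Polynomial.C.mapMatrix P = 1 := by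
    rw [← map_mul, nonsing_inv_mul _ ((isUnit_iff_isUnit_det P).1 hP), map_one]
  have hX : (Polynomial.C.mapMatrix P⁻¹ : Matrix (Fin n) (Fin n) ℝ[X]) *
      scalar (Fin n) Polynomial.X = scalar (Fin n) Polynomial.X * Polynomial.C.mapMatrix P⁻¹ :=
    (scalar_commute _ (Commute.all _) _).symm
  simp only [charmatrix, map_mul, mul_sub, sub_mul]
  rw [hX, Matrix.mul_assoc (scalar _ _), hPP, Matrix.mul_one]

theorem HasInvariantPolynomials.conj {n : ℕ} {A P : Matrix (Fin n) (Fin n) ℝ} {α : Fin n → ℝ[X]}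
    (hA : HasInvariantPolynomials A α) (hP : IsUnit P) :
    HasInvariantPolynomials (P⁻¹ * A * P) α := by
  obtain ⟨hmonic, hdvd, U, V, hU, hV, h⟩ := hA
  have hC : IsUnit (Polynomial.C.mapMatrix P : Matrix (Fin n) (Fin n) ℝ[X]) := hP.map _
  have hC' : IsUnit (Polynomial.C.mapMatrix P⁻¹ : Matrix (Fin n) (Fin n) ℝ[X]) :=
    ((isUnit_nonsing_inv_iff).2 hP).map _
  have hPP : (Polynomial.C.mapMatrix P : Matrix (Fin n) (Fin n) ℝ[X]) *
      Polynomial.C.mapMatrix P⁻¹ = 1 := by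
    rw [← map_mul, mul_nonsing_inv _ ((isUnit_iff_isUnit_det P).1 hP), map_one]
  -- Constant invertible matrices stay invertible over ℝ[s], so U and V can absorb the conjugation.
  refine ⟨hmonic, hdvd, U * Polynomial.C.mapMatrix P, Polynomial.C.mapMatrix P⁻¹ * V,
    hU.mul hC, hC'.mul hV, ?_⟩
  calc U * Polynomial.C.mapMatrix P * (P⁻¹ * A * P).charmatrix * (Polynomial.C.mapMatrix P⁻¹ * V)
      = U * (Polynomial.C.mapMatrix P * Polynomial.C.mapMatrix P⁻¹) * A.charmatrix *
          (Polynomial.C.mapMatrix P * Polynomial.C.mapMatrix P⁻¹) * V := by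
        rw [charmatrix_conj hP]
        simp only [Matrix.mul_assoc]
    _ = diagonal α := by rw [hPP, Matrix.mul_one, Matrix.mul_one, h]

theorem hasInvariantPolynomials_conj_iff {n : ℕ} {A P : Matrix (Fin n) (Fin n) ℝ}
    {α : Fin n → ℝ[X]} (hP : IsUnit P) :
    HasInvariantPolynomials (P⁻¹ * A * P) α ↔ HasInvariantPolynomials A α := by
  refine ⟨fun h => ?_, fun h => h.conj hP⟩
  have hdet := (isUnit_iff_isUnit_det P).1 hP
  -- Conjugating by P⁻¹ undoes the conjugation by P.
  have := h.conj (isUnit_nonsing_inv_iff.2 hP)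
  rwa [nonsing_inv_nonsing_inv _ hdet, Matrix.mul_assoc, mul_nonsing_inv_cancel_right _ _ hdet,
    mul_nonsing_inv_cancel_left _ _ hdet] at this

/-! ### Feedback transformations -/

section Feedback

variable {n m : ℕ} {P : Matrix (Fin n) (Fin n) ℝ} {Q : Matrix (Fin m) (Fin m) ℝ}
  {R : Matrix (Fin m) (Fin n) ℝ} {F F' : Matrix (Fin n) (Fin n) ℝ} {G G' : Matrix (Fin n) (Fin m) ℝ}

theorem IsFeedbackTransformation.closedLoop_eq (h : IsFeedbackTransformation P Q R F G F' G')
    (K : Matrix (Fin m) (Fin n) ℝ) :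
    F' + G' * (Q⁻¹ * (K * P - R)) = P⁻¹ * (F + G * K) * P := by
  obtain ⟨-, hQ, h⟩ := h
  rw [Matrix.mul_assoc, fromCols_mul_fromBlocks, mul_fromCols] at h
  obtain ⟨rfl, rfl⟩ := fromCols_inj h
  have hQdet := (isUnit_iff_isUnit_det Q).1 hQ
  simp only [Matrix.mul_zero, zero_add, Matrix.mul_assoc, mul_nonsing_inv_cancel_left _ _ hQdet,
    Matrix.mul_add, Matrix.add_mul, Matrix.mul_sub]
  abel

theorem IsFeedbackTransformation.mem_assigningFeedbacks_iff
    (h : IsFeedbackTransformation P Q R F G F' G') (α : Fin n → ℝ[X])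
    (K : Matrix (Fin m) (Fin n) ℝ) :
    Q⁻¹ * (K * P - R) ∈ assigningFeedbacks α F' G' ↔ K ∈ assigningFeedbacks α F G := by
  simp only [assigningFeedbacks, Set.mem_ofPred_eq, h.closedLoop_eq,
    hasInvariantPolynomials_conj_iff h.1]

/-- The map is linear on a finite-dimensional space, hence continuous and smooth. -/
theorem contDiff_mul_mul_left {k l p q : ℕ} (A : Matrix (Fin k) (Fin l) ℝ)
    (B : Matrix (Fin p) (Fin q) ℝ) :
    ContDiff ℝ ∞ fun K : Matrix (Fin l) (Fin p) ℝ => A * K * B :=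
  (LinearMap.toContinuousLinearMap
    (mulRightLinearMap (Fin k) ℝ B ∘ₗ mulLeftLinearMap (Fin p) ℝ A)).contDiff

/-- The map `K ↦ Q⁻¹ (K P - R)` and its inverse `K ↦ (Q K + R) P⁻¹` are smooth, and they exchange the
sets of assigning feedbacks. -/
theorem IsFeedbackTransformation.exists_inverse (h : IsFeedbackTransformation P Q R F G F' G')
    (α : Fin n → ℝ[X]) :
    ContDiff ℝ ∞ (fun K : Matrix (Fin m) (Fin n) ℝ => Q⁻¹ * (K * P - R)) ∧
    ∃ g : Matrix (Fin m) (Fin n) ℝ → Matrix (Fin m) (Fin n) ℝ, ContDiff ℝ ∞ g ∧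
      (∀ K ∈ assigningFeedbacks α F' G', g K ∈ assigningFeedbacks α F G) ∧
      (∀ K, g (Q⁻¹ * (K * P - R)) = K) ∧ ∀ K, Q⁻¹ * (g K * P - R) = K := by
  have hP := (isUnit_iff_isUnit_det P).1 h.1
  have hQ := (isUnit_iff_isUnit_det Q).1 h.2.1
  have hr : ∀ K : Matrix (Fin m) (Fin n) ℝ, Q⁻¹ * ((Q * K + R) * P⁻¹ * P - R) = K := fun K => by
    rw [nonsing_inv_mul_cancel_right _ _ hP, add_sub_cancel_right,
      nonsing_inv_mul_cancel_left _ _ hQ]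
  refine ⟨?_, fun K => (Q * K + R) * P⁻¹, ?_, fun K hK => ?_, fun K => ?_, hr⟩
  · simp only [Matrix.mul_sub, ← Matrix.mul_assoc]
    exact (contDiff_mul_mul_left _ _).sub contDiff_const
  · simp only [Matrix.add_mul]
    exact (contDiff_mul_mul_left _ _).add contDiff_const
  -- Membership of the preimage is tested on its image under ψ, which is K itself.
  · rwa [← h.mem_assigningFeedbacks_iff α, hr]
  · dsimp only
    rw [mul_nonsing_inv_cancel_left _ _ hQ, sub_add_cancel, mul_nonsing_inv_cancel_right _ _ hP]

end Feedback

end PoleAssignment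

theorem proposition3p3 (n m : ℕ) (α : Fin n → Polynomial ℝ)
    (hmonic : ∀ i, (α i).Monic) (hdvd : ∀ i j, i ≤ j → α i ∣ α j)
    (hdeg : ∑ i, (α i).natDegree = n)
    (F F' : Matrix (Fin n) (Fin n) ℝ) (G G' : Matrix (Fin n) (Fin m) ℝ)
    (hFG : PoleAssignment.IsControllable F G) (hFG' : PoleAssignment.IsControllable F' G')
    (hequiv : PoleAssignment.FeedbackEquivalent F G F' G') :
    -- the sets of assigning feedbacks are diffeomorphic (as subsets of the space of matrices)
    Nonempty (PoleAssignment.SubsetDiffeo (PoleAssignment.assigningFeedbacks α F G)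
      (PoleAssignment.assigningFeedbacks α F' G')) ∧
    -- every feedback transformation between the two pairs gives an explicit diffeomorphism
    ∀ (P : Matrix (Fin n) (Fin n) ℝ) (Q : Matrix (Fin m) (Fin m) ℝ) (R : Matrix (Fin m) (Fin n) ℝ),
      PoleAssignment.IsFeedbackTransformation P Q R F G F' G' →
      (∃ Φ : PoleAssignment.SubsetDiffeo (PoleAssignment.assigningFeedbacks α F G)
          (PoleAssignment.assigningFeedbacks α F' G'),
        ∀ K : PoleAssignment.assigningFeedbacks α F G,
          (Φ.toEquiv K : Matrix (Fin m) (Fin n) ℝ) =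
            Q⁻¹ * ((K : Matrix (Fin m) (Fin n) ℝ) * P - R)) ∧
      -- the same map is a diffeomorphism for the structures of smooth embedded submanifolds
      PoleAssignment.RestrictsToDiffeo (fun K => Q⁻¹ * (K * P - R))
        (PoleAssignment.assigningFeedbacks α F G) (PoleAssignment.assigningFeedbacks α F' G') := by
  have key : ∀ (P : Matrix (Fin n) (Fin n) ℝ) (Q : Matrix (Fin m) (Fin m) ℝ)
      (R : Matrix (Fin m) (Fin n) ℝ), PoleAssignment.IsFeedbackTransformation P Q R F G F' G' →
      (∃ Φ : PoleAssignment.SubsetDiffeo (PoleAssignment.assigningFeedbacks α F G)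
          (PoleAssignment.assigningFeedbacks α F' G'),
        ∀ K : PoleAssignment.assigningFeedbacks α F G,
          (Φ.toEquiv K : Matrix (Fin m) (Fin n) ℝ) =
            Q⁻¹ * ((K : Matrix (Fin m) (Fin n) ℝ) * P - R)) ∧
      PoleAssignment.RestrictsToDiffeo (fun K => Q⁻¹ * (K * P - R))
        (PoleAssignment.assigningFeedbacks α F G)
        (PoleAssignment.assigningFeedbacks α F' G') := by
    intro P Q R h
    obtain ⟨hf, g, hg, hTS, hgf, hfg⟩ := h.exists_inverse α
    have hST := fun K hK => (h.mem_assigningFeedbacks_iff α K).2 hK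
    exact ⟨PoleAssignment.exists_subsetDiffeo hf hg hST hTS hgf hfg,
      PoleAssignment.restrictsToDiffeo hf hg hST hTS hgf hfg⟩
  obtain ⟨P, Q, R, h⟩ := hequiv
  exact ⟨⟨(key P Q R h).1.choose⟩, key⟩
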